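/- Let $K$ be a field, $n,d\ge 0$ integers, and $S=K[x_1,\dots,x_n]$ with its $\mathbb Z^n$-grading. For an ideal $I\subset S$ generated by monomials, a Stanley decomposition of $I$ is a finite direct sum decomposition of $K$-vector spaces $$\mathcal P:\ I=\bigoplus_{i=1}^m u_iK[Z_i],$$ where each $u_i\in I$ is a nonzero $\mathbb Z^n$-homogeneous element (a nonzero scalar times a monomial) and $Z_i\subset\{x_1,\dots,x_n\}$. Put $\operatorname{sdepth}(\mathcal P)=\min_i|Z_i|$, and let the Stanley depth $\operatorname{sdepth}_S(I)$ be the maximum of $\operatorname{sdepth}(\mathcal P)$ over all Stanley decompositions $\mathcal P$ of $I$ (with the convention $\operatorname{sdepth}_S(0)=\infty$). Let $\mu_d(I)$ be the number of monomials of degree $d$ among the minimal monomial generators of $I$. **Theorem.** Let $I\subset S$ be an ideal generated by squarefree monomials of degree $\ge d$. If $$\mu_d(I)\le\min\left(\binom{n}{d+1},\ \sum_{j=1}^{n-d}\binom{2j-1}{j}\right)$$ (the sum being $0$ when $d\ge n$), then $\operatorname{sdepth}_S(I)\ge d+1$. -/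

import Mathlib

open MvPolynomial

/-- The squarefree monomial `∏ i ∈ s, x_i`. -/
noncomputable def squarefreeMonomial (K : Type*) [Field K] {n : ℕ} (s : Finset (Fin n)) :
    MvPolynomial (Fin n) K :=
  ∏ i ∈ s, X i

/-- `I` is generated by (some set of) squarefree monomials of degree at least `d`. -/
def IsGeneratedBySquarefree {K : Type*} [Field K] {n : ℕ} (d : ℕ)
    (I : Ideal (MvPolynomial (Fin n) K)) : Prop :=
  ∃ A : Set (Finset (Fin n)), (∀ s ∈ A, d ≤ s.card) ∧ I = Ideal.span (squarefreeMonomial K '' A)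

/-- Exponents of the minimal monomial generators `G(I)` of a monomial ideal `I`: the monomials
lying in `I` that are minimal with respect to divisibility. -/
def minimalGenerators {K : Type*} [Field K] {n : ℕ} (I : Ideal (MvPolynomial (Fin n) K)) :
    Set (Fin n →₀ ℕ) :=
  {a | Minimal (fun b : Fin n →₀ ℕ => monomial b (1 : K) ∈ I) a}

/-- `μ_d(I)`: the number of minimal monomial generators of `I` of total degree `d`. (There are only
finitely many monomials of degree `d`.) -/
noncomputable def numMinimalGenerators {K : Type*} [Field K] {n : ℕ} (d : ℕ)
    (I : Ideal (MvPolynomial (Fin n) K)) : ℕ :=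
  {a ∈ minimalGenerators I | a.degree = d}.ncard

/-- The `K`-subspace `u K[Z]` of the polynomial ring, where `Z` is a set of variables. -/
noncomputable def stanleySpace {K : Type*} [Field K] {n : ℕ} (u : MvPolynomial (Fin n) K)
    (Z : Finset (Fin n)) : Submodule K (MvPolynomial (Fin n) K) :=
  (Subalgebra.toSubmodule (supported K (Z : Set (Fin n)))).map (LinearMap.mulLeft K u)

/-- A Stanley decomposition `I = ⨁_{i < m} u_i K[Z_i]` of an ideal `I`, as a finite internal direct
sum of `K`-vector spaces. The elements homogeneous for the `ℤⁿ`-grading are the scalar multiples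
`c x^a` of monomials, and `u_i K[Z_i]` is a free `K[Z_i]`-module of rank one exactly when
`u_i ≠ 0`. -/
structure StanleyDecomposition {K : Type*} [Field K] {n : ℕ}
    (I : Ideal (MvPolynomial (Fin n) K)) where
  m : ℕ
  u : Fin m → MvPolynomial (Fin n) K
  Z : Fin m → Finset (Fin n)
  mem : ∀ i, u i ∈ I
  homogeneous : ∀ i, ∃ (a : Fin n →₀ ℕ) (c : K), u i = monomial a c
  ne_zero : ∀ i, u i ≠ 0
  independent : iSupIndep fun i => stanleySpace (u i) (Z i)
  iSup_eq : ⨆ i, stanleySpace (u i) (Z i) = I.restrictScalars K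

/-- The Stanley depth `min_i |Z_i|` of a decomposition (`⊤` for the empty decomposition, which
occurs only for the zero ideal). -/
noncomputable def StanleyDecomposition.depth {K : Type*} [Field K] {n : ℕ}
    {I : Ideal (MvPolynomial (Fin n) K)} (P : StanleyDecomposition I) : ℕ∞ :=
  ⨅ i, ((P.Z i).card : ℕ∞)

/-- The Stanley depth of `I`: the maximal depth of a Stanley decomposition of `I`. For `I ≠ 0` all
the depths are at most `n`, so the supremum is a maximum; `sdepth 0 = ⊤`. -/
noncomputable def sdepth {K : Type*} [Field K] {n : ℕ} (I : Ideal (MvPolynomial (Fin n) K)) : ℕ∞ :=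
  ⨆ P : StanleyDecomposition I, P.depth

/-!
The supports of the monomials of `I` form an up-closed family `F` of subsets of `Fin n`, all of
size at least `d`. A partition of `F` into intervals `[C, D]` gives a Stanley decomposition
`I = ⨁ x^C K[D]`, because `x^C K[D]` is spanned by the monomials whose support lies in `[C, D]`
(`le_sdepth_of_intervals`). It is therefore enough to find such a partition with `d + 1 ≤ |D|`
throughout, and for this it is enough to match the `d`-sets of `F`, of which there are at most
`μ_d(I)`, injectively with `(d + 1)`-sets containing them (`exists_injOn_superset`): the intervals
are then the matched pairs and the remaining sets of `F` as singletons.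

By Hall's theorem the matching exists as soon as every family of `d`-sets of size at most
`∑ j ∈ [1, n - d], (2j - 1).choose j` is no larger than its upper shadow. Passing to complements,
with `k = n - d`, this says that a family of `k`-sets of size at most
`∑ j ∈ [1, k], (2j - 1).choose j` is no larger than its lower shadow
(`card_le_card_shadow_of_card_le_sum`). If `n < 2k`, every family of `k`-sets has this property, by
double counting. Otherwise, by the Kruskal-Katona theorem, only initial segments `𝒞` of the
colexicographic order need to be considered, and these are handled by induction on `k`. Either all
members of `𝒞` lie in `{0, …, 2k - 2}`, where double counting applies again, or `𝒞` consists of all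
`k`-subsets of `{0, …, 2k - 2}` together with the sets `A ∪ {2k - 1}` for `A` in an initial segment
of `(k - 1)`-sets, to which the induction hypothesis applies. The shadows of the two parts are
separated by membership of `2k - 1`, so the two estimates add up.
-/

open Finset
open scoped FinsetFamily

/-! ### Families no larger than their shadow -/

/-- Double counting of the pairs `B ⊂ A` with `A ∈ 𝒜`, `B ∈ ∂ 𝒜`: every `A` has `k` such `B`,
and every `B` at most `#T - (k - 1) ≤ k` such `A`. -/
lemma card_le_card_shadow_of_subset {α : Type*} [DecidableEq α] {𝒜 : Finset (Finset α)}
    {k : ℕ} (hk : k ≠ 0) (h𝒜 : (𝒜 : Set (Finset α)).Sized k) (T : Finset α)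
    (hT : ∀ A ∈ 𝒜, A ⊆ T) (hcard : #T + 1 ≤ 2 * k) : #𝒜 ≤ #(∂ 𝒜) := by
  refine Nat.le_of_mul_le_mul_right (c := k) ?_ (Nat.pos_of_ne_zero hk)
  refine card_mul_le_card_mul (fun A B => B ⊆ A) (fun A hA => ?_) (fun B hB => ?_)
  · rw [← h𝒜 hA, ← card_image_of_injOn A.erase_injOn]
    refine card_le_card fun B hB => ?_
    obtain ⟨a, ha, rfl⟩ := mem_image.1 hB
    exact (mem_bipartiteAbove _).2 ⟨erase_mem_shadow hA ha, erase_subset _ _⟩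
  · obtain ⟨A, hA, hBA, hAB⟩ := mem_shadow_iff_exists_mem_card_add_one.1 hB
    have hBk : #B + 1 = k := by rw [← hAB, h𝒜 hA]
    have hle : #(T \ B) ≤ k := by
      rw [card_sdiff_of_subset (hBA.trans (hT A hA))]; omega
    refine le_trans (le_trans (card_le_card ?_) (card_image_le (s := T \ B)
      (f := fun a => insert a B))) hle
    intro C hC
    obtain ⟨hC, hBC⟩ := (mem_bipartiteBelow _).1 hC
    obtain ⟨a, haB, rfl⟩ := exists_eq_insert_iff.2 ⟨hBC, by rw [h𝒜 hC, hBk]⟩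
    exact mem_image.2 ⟨a, mem_sdiff.2 ⟨hT _ hC (mem_insert_self _ _), haB⟩, rfl⟩

lemma exists_isInitSeg_card_eq (n k : ℕ) {m : ℕ} (hm : m ≤ n.choose k) :
    ∃ 𝒞 : Finset (Finset (Fin n)), Colex.IsInitSeg 𝒞 k ∧ #𝒞 = m := by
  induction m with
  | zero => exact ⟨∅, Colex.isInitSeg_empty, rfl⟩
  | succ m ih =>
    obtain ⟨𝒞, h𝒞, hcard⟩ := ih (Nat.le_of_succ_le hm)
    have hne : (powersetCard k univ \ 𝒞).Nonempty := by
      rw [← card_pos]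
      have := le_card_sdiff 𝒞 (powersetCard k (univ : Finset (Fin n)))
      rw [card_powersetCard, card_univ, Fintype.card_fin] at this
      omega
    obtain ⟨A, hA, hmin⟩ := exists_min_image _ toColex hne
    obtain ⟨hAk, hA𝒞⟩ := mem_sdiff.1 hA
    rw [mem_powersetCard_univ] at hAk
    refine ⟨insert A 𝒞, ⟨?_, ?_⟩, by rw [card_insert_of_notMem hA𝒞, hcard]⟩
    · intro B hB
      rcases mem_insert.1 (mem_coe.1 hB) with rfl | hB
      exacts [hAk, h𝒞.1 hB]
    · rintro B C hB ⟨hCB, hCk⟩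
      refine mem_insert_of_mem ?_
      rcases mem_insert.1 hB with rfl | hB
      · by_contra hC
        exact hCB.not_ge (hmin C (mem_sdiff.2 ⟨mem_powersetCard_univ.2 hCk, hC⟩))
      · exact h𝒞.2 hB ⟨hCB, hCk⟩

/-- The elements `{0, …, m - 1}` of `Fin n`; this is all of `Fin n` if `n ≤ m`. -/
def finInitial (n m : ℕ) : Finset (Fin n) := {i | (i : ℕ) < m}

lemma mem_finInitial {n m : ℕ} {i : Fin n} : i ∈ finInitial n m ↔ (i : ℕ) < m := by
  simp [finInitial]

lemma card_finInitial {n m : ℕ} (h : m ≤ n) : #(finInitial n m) = m := by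
  rw [finInitial, Fin.card_filter_val_lt, min_eq_right h]

lemma subset_finInitial_of_le {n m : ℕ} {A B : Finset (Fin n)} (hBA : toColex B ≤ toColex A)
    (hA : A ⊆ finInitial n m) : B ⊆ finInitial n m := by
  intro i hi
  rw [mem_finInitial]
  rcases lt_or_ge m n with hm | hm
  · exact Colex.forall_lt_mono (a := (⟨m, hm⟩ : Fin n)) hBA
      (fun b hb => mem_finInitial.1 (hA hb)) i hi
  · exact i.2.trans_le hm

lemma isInitSeg_powersetCard_finInitial (n m k : ℕ) :
    Colex.IsInitSeg (powersetCard k (finInitial n m)) k := by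
  refine ⟨fun A hA => (mem_powersetCard.1 hA).2, fun A B hA hB => mem_powersetCard.2 ⟨?_, hB.2⟩⟩
  exact subset_finInitial_of_le hB.1.le (mem_powersetCard.1 hA).1

lemma Finset.Colex.IsInitSeg.subset_finInitial {n m k : ℕ} {𝒞 : Finset (Finset (Fin n))}
    (h𝒞 : Colex.IsInitSeg 𝒞 k) (hm : m ≤ n) (hcard : #𝒞 ≤ m.choose k) :
    ∀ A ∈ 𝒞, A ⊆ finInitial n m := by
  have hsub : 𝒞 ⊆ powersetCard k (finInitial n m) := by
    rcases h𝒞.total (isInitSeg_powersetCard_finInitial n m k) with h | h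
    · exact h
    · refine (eq_of_subset_of_card_le h ?_).ge
      rwa [card_powersetCard, card_finInitial hm]
  exact fun A hA => (mem_powersetCard.1 (hsub hA)).1

/-- The bound which guarantees that, in the inductive step for initial segments of colex, no member
uses an element beyond `2k - 1`. -/
lemma sum_choose_le_choose_two_mul (k : ℕ) :
    ∑ j ∈ Icc 1 k, (2 * j - 1).choose j ≤ (2 * k).choose k := by
  induction k with
  | zero => simp
  | succ k ih =>
    rw [sum_Icc_succ_top (by omega), show 2 * (k + 1) - 1 = 2 * k + 1 by omega,
      show 2 * (k + 1) = (2 * k + 1) + 1 by omega, Nat.choose_succ_succ (2 * k + 1) k]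
    gcongr
    refine ih.trans ?_
    exact Nat.choose_le_choose k (Nat.le_succ _)

lemma Finset.Colex.IsInitSeg.card_le_card_shadow {n k : ℕ} {𝒞 : Finset (Finset (Fin n))}
    (h𝒞 : Colex.IsInitSeg 𝒞 k) (hkn : 2 * k ≤ n)
    (hcard : #𝒞 ≤ ∑ j ∈ Icc 1 k, (2 * j - 1).choose j) : #𝒞 ≤ #(∂ 𝒞) := by
  induction k generalizing 𝒞 with
  | zero => simp_all
  | succ k ih =>
    rcases le_or_gt #𝒞 ((2 * k + 1).choose (k + 1)) with hle | hlt
    · exact card_le_card_shadow_of_subset k.succ_ne_zero h𝒞.1 (finInitial n (2 * k + 1))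
        (h𝒞.subset_finInitial (by omega) hle) (by rw [card_finInitial (by omega)]; omega)
    · have hsub : ∀ A ∈ 𝒞, A ⊆ finInitial n (2 * (k + 1)) :=
        h𝒞.subset_finInitial hkn (hcard.trans (sum_choose_le_choose_two_mul _))
      have hQ : powersetCard (k + 1) (finInitial n (2 * k + 1)) ⊆ 𝒞 := by
        rcases h𝒞.total (isInitSeg_powersetCard_finInitial n (2 * k + 1) (k + 1)) with h | h
        · have := card_le_card h
          rw [card_powersetCard, card_finInitial (by omega)] at this
          omega
        · exact h
      -- `e` is the largest element a member of `𝒞` can contain. The members avoiding `e` form all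
      -- `(k + 1)`-subsets of `{0, …, 2k}`, and the members through `e`, with `e` removed, form an
      -- initial segment of `k`-sets.
      let e : Fin n := ⟨2 * k + 1, by omega⟩
      have herase : ∀ A ⊆ finInitial n (2 * (k + 1)), e ∉ A → A ⊆ finInitial n (2 * k + 1) := by
        intro A hA he i hi
        have h1 := mem_finInitial.1 (hA hi)
        have h2 : (i : ℕ) ≠ 2 * k + 1 := fun h => he (by rwa [show e = i from Fin.ext h.symm])
        exact mem_finInitial.2 (by omega)
      have hnon : 𝒞.nonMemberSubfamily e = powersetCard (k + 1) (finInitial n (2 * k + 1)) := by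
        ext A
        rw [mem_nonMemberSubfamily, mem_powersetCard]
        refine ⟨fun ⟨hA, he⟩ => ⟨herase A (hsub A hA) he, h𝒞.1 hA⟩, fun hA => ⟨?_, fun he => ?_⟩⟩
        · exact hQ (mem_powersetCard.2 hA)
        · exact absurd (mem_finInitial.1 (hA.1 he)) (lt_irrefl _)
      have hmemsub : ∀ A ∈ 𝒞.memberSubfamily e, A ⊆ finInitial n (2 * k + 1) := by
        intro A hA
        obtain ⟨hA, he⟩ := mem_memberSubfamily.1 hA
        exact herase A ((subset_insert _ _).trans (hsub _ hA)) he
      have hmem : Colex.IsInitSeg (𝒞.memberSubfamily e) k := by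
        refine ⟨fun A hA => ?_, fun A B hA hB => ?_⟩
        · obtain ⟨hA, he⟩ := mem_memberSubfamily.1 hA
          have := h𝒞.1 hA
          rw [card_insert_of_notMem he] at this
          omega
        · have hBsub := subset_finInitial_of_le hB.1.le (hmemsub A hA)
          have heB : e ∉ B := fun h => absurd (mem_finInitial.1 (hBsub h)) (lt_irrefl _)
          obtain ⟨hA, he⟩ := mem_memberSubfamily.1 hA
          refine mem_memberSubfamily.2 ⟨h𝒞.2 hA ⟨?_, ?_⟩, heB⟩
          · rw [← Colex.toColex_sdiff_lt_toColex_sdiff (u := {e}) (by simp) (by simp),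
              sdiff_singleton_eq_erase, sdiff_singleton_eq_erase, erase_insert heB,
              erase_insert he]
            exact hB.1
          · rw [card_insert_of_notMem heB, hB.2]
      have hsum := card_memberSubfamily_add_card_nonMemberSubfamily e 𝒞
      have hsum' := card_memberSubfamily_add_card_nonMemberSubfamily e (∂ 𝒞)
      have hcardnon : #(𝒞.nonMemberSubfamily e) = (2 * k + 1).choose (k + 1) := by
        rw [hnon, card_powersetCard, card_finInitial (by omega)]
      rw [sum_Icc_succ_top (by omega), show 2 * (k + 1) - 1 = 2 * k + 1 by omega] at hcard
      -- Adding `e` to a shadow element of the part through `e` gives a shadow element of `𝒞`.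
      have h1 : #(𝒞.memberSubfamily e) ≤ #((∂ 𝒞).memberSubfamily e) := by
        refine (ih hmem (by omega) (by omega)).trans (card_le_card fun B hB => ?_)
        obtain ⟨a, ha, hB⟩ := mem_shadow_iff_insert_mem.1 hB
        obtain ⟨hB, he⟩ := mem_memberSubfamily.1 hB
        rw [mem_insert, not_or] at he
        refine mem_memberSubfamily.2 ⟨mem_shadow_iff_insert_mem.2 ⟨a, ?_, ?_⟩, he.2⟩
        · rw [mem_insert, not_or]
          exact ⟨fun h => he.1 h.symm, ha⟩
        · rwa [insert_comm]
      have h2 : #(𝒞.nonMemberSubfamily e) ≤ #((∂ 𝒞).nonMemberSubfamily e) := by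
        refine (card_le_card_shadow_of_subset k.succ_ne_zero (fun A hA => ?_)
          (finInitial n (2 * k + 1)) (fun A hA => ?_) ?_).trans (card_le_card fun B hB => ?_)
        · exact h𝒞.1 (mem_nonMemberSubfamily.1 hA).1
        · rw [hnon] at hA
          exact (mem_powersetCard.1 hA).1
        · rw [card_finInitial (by omega)]; omega
        · obtain ⟨A, hA, a, ha, rfl⟩ := mem_shadow_iff.1 hB
          obtain ⟨hA, he⟩ := mem_nonMemberSubfamily.1 hA
          exact mem_nonMemberSubfamily.2
            ⟨erase_mem_shadow hA ha, fun h => he (mem_of_mem_erase h)⟩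
      omega

theorem card_le_card_shadow_of_card_le_sum {n k : ℕ} {𝒜 : Finset (Finset (Fin n))}
    (h𝒜 : (𝒜 : Set (Finset (Fin n))).Sized k)
    (hcard : #𝒜 ≤ ∑ j ∈ Icc 1 k, (2 * j - 1).choose j) : #𝒜 ≤ #(∂ 𝒜) := by
  rcases Nat.eq_zero_or_pos k with rfl | hk
  · simp_all
  rcases le_or_gt (2 * k) n with hkn | hkn
  · obtain ⟨𝒞, h𝒞, h⟩ := exists_isInitSeg_card_eq n k (m := #𝒜)
      (by simpa using h𝒜.card_le)
    rw [← h] at hcard ⊢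
    exact (h𝒞.card_le_card_shadow hkn hcard).trans (kruskal_katona h𝒜 h.le h𝒞)
  · exact card_le_card_shadow_of_subset hk.ne' h𝒜 univ (fun A _ => subset_univ A)
      (by simpa using hkn)

theorem card_le_card_upShadow_of_card_le_sum {n d : ℕ} {𝒜 : Finset (Finset (Fin n))}
    (h𝒜 : (𝒜 : Set (Finset (Fin n))).Sized d)
    (hcard : #𝒜 ≤ ∑ j ∈ Icc 1 (n - d), (2 * j - 1).choose j) : #𝒜 ≤ #(∂⁺ 𝒜) := by
  have h := card_le_card_shadow_of_card_le_sum (𝒜 := 𝒜ᶜˢ) (k := n - d) (by simpa using h𝒜.compls)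
    (by simpa using hcard)
  simpa using h

/-! ### Matching sets with supersets -/

/-- Hall's theorem for the relation "superset with one more element" on the `d`-sets in `𝒜`. -/
lemma exists_injOn_superset {n d : ℕ} {𝒜 : Finset (Finset (Fin n))}
    (h𝒜 : (𝒜 : Set (Finset (Fin n))).Sized d)
    (hcard : #𝒜 ≤ ∑ j ∈ Icc 1 (n - d), (2 * j - 1).choose j) :
    ∃ f : Finset (Fin n) → Finset (Fin n), Set.InjOn f 𝒜 ∧
      ∀ s ∈ 𝒜, s ⊆ f s ∧ #(f s) = d + 1 := by
  obtain ⟨g, hg, hmem⟩ := (all_card_le_biUnion_card_iff_exists_injective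
    (fun s : 𝒜 => ∂⁺ {(s : Finset (Fin n))})).1 fun 𝒮 => by
      have hsub : 𝒮.map (Function.Embedding.subtype _) ⊆ 𝒜 := fun s hs => by
        obtain ⟨t, -, rfl⟩ := mem_map.1 hs
        exact t.2
      rw [← card_map (Function.Embedding.subtype _)]
      refine (card_le_card_upShadow_of_card_le_sum (fun s hs => h𝒜 (hsub hs))
        ((card_le_card hsub).trans hcard)).trans (card_le_card fun t ht => ?_)
      obtain ⟨s, hs, a, ha, rfl⟩ := mem_upShadow_iff.1 ht
      obtain ⟨r, hr, rfl⟩ := mem_map.1 hs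
      exact mem_biUnion.2 ⟨r, hr, insert_mem_upShadow (mem_singleton_self _) ha⟩
  refine ⟨fun s => if h : s ∈ 𝒜 then g ⟨s, h⟩ else s, fun s hs t ht hst => ?_, fun s hs => ?_⟩
  · rw [mem_coe] at hs ht
    simp only [dif_pos hs, dif_pos ht] at hst
    exact congrArg Subtype.val (hg hst)
  · simp only [dif_pos hs]
    obtain ⟨t, ht, a, ha, hga⟩ := mem_upShadow_iff.1 (hmem ⟨s, hs⟩)
    rw [mem_singleton] at ht
    subst ht
    rw [← hga, card_insert_of_notMem ha, h𝒜 hs]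
    exact ⟨subset_insert _ _, rfl⟩

/-! ### Stanley decompositions from interval partitions -/

/-- The exponent of the squarefree monomial `∏ i ∈ s, x_i`. -/
noncomputable def squarefreeExponent {n : ℕ} (s : Finset (Fin n)) : Fin n →₀ ℕ :=
  ∑ i ∈ s, Finsupp.single i 1

lemma squarefreeExponent_apply {n : ℕ} (s : Finset (Fin n)) (i : Fin n) :
    squarefreeExponent s i = if i ∈ s then 1 else 0 := by
  simp [squarefreeExponent, Finsupp.finsetSum_apply, Finsupp.single_apply]

lemma squarefreeExponent_le_iff {n : ℕ} {s : Finset (Fin n)} {a : Fin n →₀ ℕ} :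
    squarefreeExponent s ≤ a ↔ s ⊆ a.support := by
  refine ⟨fun h i hi => ?_, fun h i => ?_⟩
  · have := h i
    rw [squarefreeExponent_apply, if_pos hi] at this
    exact Finsupp.mem_support_iff.2 (by omega)
  · rw [squarefreeExponent_apply]
    split_ifs with hi
    · exact Nat.pos_of_ne_zero (Finsupp.mem_support_iff.1 (h hi))
    · exact Nat.zero_le _

lemma support_squarefreeExponent {n : ℕ} (s : Finset (Fin n)) :
    (squarefreeExponent s).support = s := by
  ext i
  simp [squarefreeExponent_apply]

lemma degree_squarefreeExponent {n : ℕ} (s : Finset (Fin n)) :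
    (squarefreeExponent s).degree = #s := by
  simp [squarefreeExponent, map_sum]

lemma squarefreeMonomial_eq {K : Type*} [Field K] {n : ℕ} (s : Finset (Fin n)) :
    squarefreeMonomial K s = monomial (squarefreeExponent s) 1 := by
  rw [squarefreeExponent, monomial_sum_one]
  rfl

/-- For `C ⊆ D`, the space `x^C K[D]` is spanned by the monomials with support in `[C, D]`. -/
lemma stanleySpace_squarefreeExponent {K : Type*} [Field K] {n : ℕ} {C D : Finset (Fin n)}
    (hCD : C ⊆ D) : stanleySpace (monomial (squarefreeExponent C) (1 : K)) D =
      restrictSupport K {a | C ⊆ a.support ∧ a.support ⊆ D} := by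
  have hsupp : Subalgebra.toSubmodule (supported K (D : Set (Fin n))) =
      restrictSupport K {a | a.support ⊆ D} := by
    ext p
    rw [Subalgebra.mem_toSubmodule, mem_supported, mem_restrictSupport_iff]
    refine ⟨fun h a ha i hi => ?_, fun h i hi => ?_⟩
    · exact h (mem_coe.2 ((mem_vars_iff_mem_support i).2 ⟨a, ha, hi⟩))
    · obtain ⟨a, ha, hi⟩ := (mem_vars_iff_mem_support i).1 (mem_coe.1 hi)
      exact h ha hi
  rw [stanleySpace, hsupp, restrictSupport_eq_span, restrictSupport_eq_span, Submodule.map_span]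
  congr 1
  ext p
  constructor
  · rintro ⟨_, ⟨a, ha, rfl⟩, rfl⟩
    refine ⟨squarefreeExponent C + a, ⟨?_, ?_⟩, by simp⟩
    · exact squarefreeExponent_le_iff.1 le_self_add
    · refine Finsupp.support_add.trans (union_subset ?_ ha)
      rwa [support_squarefreeExponent]
  · rintro ⟨a, ⟨hC, hD⟩, rfl⟩
    refine ⟨monomial (a - squarefreeExponent C) 1, ⟨_, ?_, rfl⟩, ?_⟩
    · exact (Finsupp.support_mono tsub_le_self).trans hD
    · simp [add_tsub_cancel_of_le (squarefreeExponent_le_iff.2 hC)]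

lemma iSupIndep_restrictSupport {R σ ι : Type*} [CommSemiring R] {S : ι → Set (σ →₀ ℕ)}
    (hS : Pairwise fun i j => Disjoint (S i) (S j)) :
    iSupIndep fun i => restrictSupport R (S i) := by
  intro i
  refine Disjoint.mono_right (iSup₂_le fun j hj => restrictSupport_mono (t := (S i)ᶜ) R
    (hS hj).subset_compl_right) ?_
  rw [Submodule.disjoint_def]
  intro p hp hp'
  rw [mem_restrictSupport_iff] at hp hp'
  rw [← support_eq_empty, Finset.eq_empty_iff_forall_notMem]
  exact fun a ha => hp' ha (hp ha)

lemma iSup_restrictSupport {R σ ι : Type*} [CommSemiring R] (S : ι → Set (σ →₀ ℕ)) :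
    ⨆ i, restrictSupport R (S i) = restrictSupport R (⋃ i, S i) := by
  simp_rw [restrictSupport_eq_span, Set.image_iUnion, Submodule.span_iUnion]

/-- A partition of the family `F` of supports of monomials of `I` into intervals `[C i, D i]` gives
the Stanley decomposition `I = ⨁ x^(C i) K[D i]`. -/
theorem le_sdepth_of_intervals {K : Type*} [Field K] {n k : ℕ}
    {I : Ideal (MvPolynomial (Fin n) K)} {F : Set (Finset (Fin n))}
    (hI : I.restrictScalars K = restrictSupport K {a | a.support ∈ F})
    {ι : Type*} [Finite ι] (C D : ι → Finset (Fin n)) (hCD : ∀ i, C i ⊆ D i)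
    (hF : ∀ s, s ∈ F ↔ ∃ i, C i ⊆ s ∧ s ⊆ D i)
    (hdisj : ∀ s i j, C i ⊆ s → s ⊆ D i → C j ⊆ s → s ⊆ D j → i = j)
    (hk : ∀ i, k ≤ #(D i)) : (k : ℕ∞) ≤ sdepth I := by
  obtain ⟨m, ⟨e⟩⟩ := Finite.exists_equiv_fin ι
  let P : StanleyDecomposition I :=
    { m := m
      u := fun i => monomial (squarefreeExponent (C (e.symm i))) 1
      Z := fun i => D (e.symm i)
      mem := fun i => by
        rw [← Submodule.restrictScalars_mem K, hI, monomial_mem_restrictSupport]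
        left
        rw [Set.mem_ofPred_eq, support_squarefreeExponent]
        exact (hF _).2 ⟨e.symm i, Subset.rfl, hCD _⟩
      homogeneous := fun i => ⟨_, _, rfl⟩
      ne_zero := fun i => by simp [monomial_eq_zero]
      independent := by
        simp_rw [stanleySpace_squarefreeExponent (hCD _)]
        refine iSupIndep_restrictSupport fun i j hij => Set.disjoint_left.2 fun a ha ha' => hij ?_
        exact e.symm.injective (hdisj a.support _ _ ha.1 ha.2 ha'.1 ha'.2)
      iSup_eq := by
        simp_rw [stanleySpace_squarefreeExponent (hCD _)]
        rw [iSup_restrictSupport, hI]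
        congr 1
        ext a
        simp only [Set.mem_iUnion, Set.mem_ofPred_eq, hF]
        exact e.symm.exists_congr_left.trans (by simp) }
  refine le_trans ?_ (le_iSup StanleyDecomposition.depth P)
  exact le_iInf fun i => Nat.cast_le.2 (hk _)

lemma restrictScalars_span_squarefreeMonomial {K : Type*} [Field K] {n : ℕ}
    (A : Set (Finset (Fin n))) :
    (Ideal.span (squarefreeMonomial K '' A)).restrictScalars K =
      restrictSupport K {a | a.support ∈ {s | ∃ t ∈ A, t ⊆ s}} := by
  ext p
  have hA : squarefreeMonomial K '' A =
      (fun a => monomial a (1 : K)) '' (squarefreeExponent '' A) := by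
    rw [Set.image_image]
    exact Set.image_congr fun s _ => squarefreeMonomial_eq s
  rw [Submodule.restrictScalars_mem, hA, mem_ideal_span_monomial_image, mem_restrictSupport_iff]
  simp [Set.subset_def, squarefreeExponent_le_iff]

/-- The squarefree monomials of the least possible degree `d` in `I` are minimal generators. -/
lemma card_le_numMinimalGenerators {K : Type*} [Field K] {n d : ℕ}
    {I : Ideal (MvPolynomial (Fin n) K)} {F : Set (Finset (Fin n))}
    (hI : I.restrictScalars K = restrictSupport K {a | a.support ∈ F})
    (hF : ∀ s ∈ F, d ≤ #s) {𝒜 : Finset (Finset (Fin n))} (h𝒜 : ∀ s ∈ 𝒜, s ∈ F ∧ #s = d) :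
    #𝒜 ≤ numMinimalGenerators d I := by
  have hmem : ∀ a : Fin n →₀ ℕ, monomial a (1 : K) ∈ I ↔ a.support ∈ F := fun a => by
    rw [← Submodule.restrictScalars_mem K, hI, monomial_mem_restrictSupport]
    simp
  rw [numMinimalGenerators, ← Set.ncard_coe_finset]
  refine Set.ncard_le_ncard_of_injOn squarefreeExponent (fun s hs => ?_) (fun s _ t _ hst => ?_) ?_
  · obtain ⟨hsF, hsd⟩ := h𝒜 s hs
    refine ⟨⟨?_, fun b hb hbs => ?_⟩, by rw [degree_squarefreeExponent, hsd]⟩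
    · simpa [hmem, support_squarefreeExponent] using hsF
    · rw [squarefreeExponent_le_iff]
      have hsub : b.support ⊆ s := by
        simpa [support_squarefreeExponent] using Finsupp.support_mono hbs
      exact (eq_of_subset_of_card_le hsub (hsd ▸ hF _ ((hmem b).1 hb))).ge
  · rw [← support_squarefreeExponent s, hst, support_squarefreeExponent]
  -- The set counted by `numMinimalGenerators` is finite, so its `ncard` is not a junk value.
  · refine (Set.finite_Iic (Finsupp.equivFunOnFinite.symm fun _ : Fin n => d)).subset ?_
    rintro a ⟨-, rfl⟩ i
    exact Finsupp.le_degree i a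

/-! ### The Stanley depth -/

theorem theorem1p1 {K : Type*} [Field K] (n d : ℕ) (I : Ideal (MvPolynomial (Fin n) K))
    (hI : IsGeneratedBySquarefree d I)
    (hmu : numMinimalGenerators d I ≤
      min (n.choose (d + 1)) (∑ j ∈ Finset.Icc 1 (n - d), (2 * j - 1).choose j)) :
    ((d + 1 : ℕ) : ℕ∞) ≤ sdepth I := by
  classical
  obtain ⟨A, hA, rfl⟩ := hI
  have hres := restrictScalars_span_squarefreeMonomial (K := K) A
  set F : Set (Finset (Fin n)) := {s | ∃ t ∈ A, t ⊆ s} with hFdef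
  have hFd : ∀ s ∈ F, d ≤ #s := fun s ⟨t, ht, hts⟩ => (hA t ht).trans (card_le_card hts)
  have hFup : ∀ s ∈ F, ∀ t, s ⊆ t → t ∈ F := fun s ⟨r, hr, hrs⟩ t hst => ⟨r, hr, hrs.trans hst⟩
  let 𝒜 : Finset (Finset (Fin n)) := {s | s ∈ F ∧ #s = d}
  have h𝒜 : ∀ s, s ∈ 𝒜 ↔ s ∈ F ∧ #s = d := fun s => by simp [𝒜]
  obtain ⟨f, hinj, hf⟩ := exists_injOn_superset (fun s hs => ((h𝒜 s).1 hs).2)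
    ((card_le_numMinimalGenerators hres hFd fun s hs => (h𝒜 s).1 hs).trans
      (hmu.trans (min_le_right _ _)))
  -- A `d`-set `s` of `F` spans the interval `{s, f s}`, any other set is an interval by itself.
  -- The lower ends are the sets of `F` which are not the upper end of a matched pair.
  let D : Finset (Fin n) → Finset (Fin n) := fun s => if s ∈ 𝒜 then f s else s
  have hD : ∀ s, s ⊆ D s := fun s => by
    by_cases hs : s ∈ 𝒜
    · simpa [D, hs] using (hf s hs).1
    · simp [D, hs]
  -- The intervals have at most two elements, since `f C` has only one element more than `C`.
  have hmid : ∀ s C, C ⊆ s → s ⊆ D C → s = C ∨ C ∈ 𝒜 ∧ s = f C := fun s C hC hs => by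
    by_cases hCA : C ∈ 𝒜
    · simp only [D, if_pos hCA] at hs
      rcases hC.eq_or_ssubset with h | h
      · exact Or.inl h.symm
      · refine Or.inr ⟨hCA, eq_of_subset_of_card_le hs ?_⟩
        rw [(hf C hCA).2, ← ((h𝒜 C).1 hCA).2]
        exact card_lt_card h
    · simp only [D, if_neg hCA] at hs
      exact Or.inl (hs.antisymm hC)
  refine le_sdepth_of_intervals hres (ι := {s // s ∈ F ∧ s ∉ 𝒜.image f})
    (fun s => s.1) (fun s => D s.1) (fun s => hD s.1) (fun s => ⟨fun hs => ?_, ?_⟩) ?_ ?_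
  · by_cases him : s ∈ 𝒜.image f
    · obtain ⟨t, ht, rfl⟩ := mem_image.1 him
      refine ⟨⟨t, ((h𝒜 t).1 ht).1, fun h => ?_⟩, (hf t ht).1, by simp [D, ht]⟩
      obtain ⟨r, hr, hrt⟩ := mem_image.1 h
      have h1 := (hf r hr).2
      rw [hrt, ((h𝒜 t).1 ht).2] at h1
      omega
    · exact ⟨⟨s, hs, him⟩, Subset.rfl, hD s⟩
  · rintro ⟨⟨C, hC, _⟩, hCs, _⟩
    exact hFup C hC s hCs
  · rintro s ⟨C, hC, hCim⟩ ⟨C', hC', hCim'⟩ h1 h2 h3 h4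
    rw [Subtype.mk.injEq]
    rcases hmid s C h1 h2 with rfl | ⟨hCA, rfl⟩
    · rcases hmid s C' h3 h4 with h | ⟨hCA', rfl⟩
      · exact h
      · exact absurd (mem_image_of_mem f hCA') hCim
    · rcases hmid _ C' h3 h4 with rfl | ⟨hCA', h⟩
      · exact absurd (mem_image_of_mem f hCA) hCim'
      · exact hinj hCA hCA' h
  · rintro ⟨C, hC, -⟩
    by_cases hCA : C ∈ 𝒜
    · simp only [D, if_pos hCA, (hf C hCA).2, le_refl]
    · simp only [D, if_neg hCA]
      exact lt_of_le_of_ne (hFd C hC) fun h => hCA ((h𝒜 C).2 ⟨hC, h.symm⟩)
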